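/- Convention: $\log x$ means $\max\{1,\log_2 x\}$ throughout. For $c>0$ put $g_c(q)=\left\lceil \frac{c\,q\log q\log n}{\log\log q}\right\rceil$. Let each $v\in[n]=\{1,\dots,n\}$ have a binary sequence $S^v=S^v_0S^v_1\cdots S^v_{g_c(n)-1}$, entries outside this range being read as $0$. The family $S=\{S^v\}_{v\in[n]}$ is an $(n,g_c)$-universal radio synchronizer if $g_c$ is non-decreasing on $[n]$ and, for every $\omega:[n]\to\mathbb N$ and every nonempty $X\subseteq[n]$, with $\omega(X)=\min_{v\in X}\omega(v)$, there is a $j$ with $\omega(X)\le j<\omega(X)+g_c(|X|)$ and $\sum_{v\in X}S^v_{j-\omega(v)}=1$. A radio network on $n$ nodes with distinct IDs in $[n]$ is a directed graph without loops in which every node is reachable from every other (undirected networks are the symmetric ones). Time proceeds in synchronous steps. In each step a node transmits to all its out-neighbors or listens, and a listening node receives a message if and only if precisely one of its in-neighbors transmits. Some nonempty set of nodes wakes up spontaneously, at arbitrary time steps; a node becomes active in step $i$ if it spontaneously wakes up at $i$ or received its first transmission at step $i-1$; inactive nodes do not transmit. There is no global clock. In the wake-up algorithm with $S$, a node $v$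 that becomes active in step $i$ transmits in step $i+j$ if and only if $S^v_j=1$, for $j=0,\dots,g_c(n)-1$, and is silent afterwards. Theorem 5. (i) There is a constant $c>0$ such that for every $n$ an $(n,g_c)$-universal radio synchronizer exists. (ii) For every $c>0$ there is a constant $C>0$, depending only on $c$, such that for every $n$, every $(n,g_c)$-universal radio synchronizer $S$, every directed or undirected radio network on $n$ nodes and every pattern of spontaneous wake-ups, the wake-up algorithm with $S$ makes all nodes active within $$C\cdot\frac{\min\{n,D\Delta\}\,\log n\,\log\Delta}{\log\log\Delta}$$ time steps after the first spontaneous wake-up. Here $\Delta$ is the maximum in-degree, and $D$ is the eccentricity of (any) first active node, that is, the maximum distance from it to a node of the network. -/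

import Mathlib

noncomputable section

namespace RadioWakeUp

/-- The logarithm convention: `log x` stands for `max {1, log₂ x}`, which keeps all
logarithms (and iterated logarithms) at least `1`. -/
def lg (x : ℝ) : ℝ := max 1 (Real.logb 2 x)

/-! ### Universal radio synchronizers -/

/-- A family of binary sequences of length `m`, one for each `v ∈ [n]`. -/
abbrev SeqFamily (n m : ℕ) := Fin n → Fin m → Bool

/-- The entry `S^v_{j - ω(v)}` read in column `j` under the activation schedule `ω`, as a number
in `{0, 1}`. It is `0` if `j - ω(v)` is not an index of the sequence `S^v`. -/
def entry {n m : ℕ} (S : SeqFamily n m) (ω : Fin n → ℕ) (v : Fin n) (j : ℕ) : ℕ :=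
  if h : ω v ≤ j ∧ j - ω v < m then (S v ⟨j - ω v, h.2⟩).toNat else 0

/-- `S` is an `(n, g)`-universal radio synchronizer: the delay function `g` is non-decreasing on
`[n]`, and for every activation schedule `ω` every nonempty `X ⊆ [n]` is hit by some column `j`
with `ω(X) ≤ j < ω(X) + g(|X|)`, where `ω(X) = min_{v ∈ X} ω(v)`. -/
def IsUniversalRadioSynchronizer (n : ℕ) (g : ℕ → ℕ) {m : ℕ} (S : SeqFamily n m) : Prop :=
  MonotoneOn g (Set.Icc 1 n) ∧
    ∀ (ω : Fin n → ℕ) (X : Finset (Fin n)) (hX : X.Nonempty),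
      ∃ j : ℕ, X.inf' hX ω ≤ j ∧ j < X.inf' hX ω + g X.card ∧ ∑ v ∈ X, entry S ω v j = 1

/-- The delay function `g(q) = c q log q log n / log log q`. For a natural number `j`,
`j < ⌈x⌉₊` is the same as `(j : ℝ) < x`, so rounding up does not change which columns count. -/
def delay (c : ℝ) (n q : ℕ) : ℕ := ⌈c * q * lg q * lg n / lg (lg q)⌉₊

/-! ### Radio networks -/

/-- A radio network with `n` nodes, identified with their IDs. `Adj u v` means that `u` can send
directly to `v`. Every node is reachable from every other node. An undirected network is one whose
relation `Adj` is symmetric. -/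
structure RadioNetwork (n : ℕ) extends Digraph (Fin n) where
  loopless : ∀ v, ¬ Adj v v
  reachable : ∀ u v, Relation.ReflTransGen Adj u v

namespace RadioNetwork

variable {n : ℕ} (N : RadioNetwork n)

/-- There is a directed walk of length `k` from `u` to `v`. -/
def HasWalk : ℕ → Fin n → Fin n → Prop
  | 0, u, v => u = v
  | k + 1, u, v => ∃ w, HasWalk k u w ∧ N.Adj w v

/-- Directed distance from `u` to `v` (finite, since `v` is reachable from `u`). -/
def dist (u v : Fin n) : ℕ := sInf {k | N.HasWalk k u v}

/-- Eccentricity of `u`: the largest distance from `u` to a node. -/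
def ecc (u : Fin n) : ℕ := Finset.univ.sup fun v => N.dist u v

open Classical in
/-- The in-degree of `v`. -/
def inDegree (v : Fin n) : ℕ := (Finset.univ.filter fun u => N.Adj u v).card

/-- The maximum in-degree. -/
def maxInDegree : ℕ := Finset.univ.sup fun v => N.inDegree v

end RadioNetwork

/-! ### Executions without a global clock -/

/-- An oblivious local rule: `R v j` says that the node with ID `v` transmits in the `j`-th time
step after its own activation. It sees the ID and the local time, but no global clock. -/
abbrev LocalRule (n : ℕ) := Fin n → ℕ → Prop

/-- `v` transmits in time step `t`, if `act u = some i` says that `u` is active in time step `t`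
and became active in time step `i`. -/
def Transmits {n : ℕ} (R : LocalRule n) (act : Fin n → Option ℕ) (t : ℕ) (v : Fin n) : Prop :=
  ∃ i, act v = some i ∧ R v (t - i)

/-- `v` receives a message in time step `t`: it listens and precisely one of its in-neighbors
transmits (no collision detection). -/
def Receives {n : ℕ} (N : RadioNetwork n) (R : LocalRule n) (act : Fin n → Option ℕ) (t : ℕ)
    (v : Fin n) : Prop :=
  ¬ Transmits R act t v ∧ ∃! u, N.Adj u v ∧ Transmits R act t u

open Classical in
/-- The execution of `R` on `N`. Here `wake v = some i` says that `v` spontaneously wakes up in time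
step `i` (if it is not active before), and `wake v = none` that it never does.
`activation N R wake t v` is `some i` if `v` is active in time step `t` and became active in time
step `i ≤ t`, and `none` if `v` is not active in time step `t`. A node becomes active in time
step `i` if it spontaneously wakes up at `i` or received its first transmission at `i - 1`. -/
def activation {n : ℕ} (N : RadioNetwork n) (R : LocalRule n) (wake : Fin n → Option ℕ) :
    ℕ → Fin n → Option ℕ
  | 0, v => if wake v = some 0 then some 0 else none
  | t + 1, v =>
    match activation N R wake t v with
    | some i => some i
    | none =>
      if wake v = some (t + 1) ∨ Receives N R (activation N R wake t) t v then some (t + 1)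
      else none

/-- The wake-up algorithm: from its activation on, for `j = 0, …, m - 1`, node `v` transmits in its
`j`-th time step if and only if `S^v_j = 1`; afterwards it stays silent. -/
def wakeUpAlgorithm {n m : ℕ} (S : SeqFamily n m) : LocalRule n :=
  fun v j => ∃ h : j < m, S v ⟨j, h⟩ = true

/-- Running `R` on `N` with spontaneous wake-ups `wake`, where `t₀` is the time step of the first
activation, every node is active after at most `T` further time steps. -/
def WakesUpWithin {n : ℕ} (N : RadioNetwork n) (R : LocalRule n) (wake : Fin n → Option ℕ)
    (t₀ : ℕ) (T : ℝ) : Prop :=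
  ∃ k : ℕ, (k : ℝ) ≤ T ∧ ∀ v, (activation N R wake (t₀ + k) v).isSome

end RadioWakeUp

end

/-!
Existence is shown by the probabilistic method. The entries of the sequences are independent, and
position `t` is `1` with probability `a / (t + 2 a)`, where `a` is a large multiple of `lg n`. Fix a
set `X` of `q` nodes with activation times. A smallest set that is missed is critical
(`isUniversalRadioSynchronizer_of_critical`): at every time, the window of the nodes activated so
far is still open. So in column `j` there are enough active nodes, all of age at most `j`, for the
load (the expected number of ones) to be at least of order `lg (lg q) / lg q`
(`IsCritical.le_load`). The total load of the window is at most of order `q lg n lg q`, so on most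
columns the load is at most a small multiple of `lg (lg q)`. A column with load `f` has exactly one
`1` with probability at least `f e ^ (-2 f)`, and these probabilities add up to a multiple of
`q lg n` (`IsCritical.le_sum_load_mul_exp`). Distinct columns read distinct entries and are hence
independent, so that a critical schedule is missed with probability `n ^ (-Ω(q))`, which beats the
number of schedules.

For the wake-up time, take a shortest walk `P 0, …, P d` from the first active node to a given node,
and put a node `u` into layer `i` if `P i` is the last node of the walk to which `u` can send. As
long as nothing is active beyond layer `i`, the only active in-neighbors of `P i` are in layer `i`,
so that the synchronizer wakes up `P i`, which is beyond layer `i`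
(`exists_active_beyond_layer`). Layer `i` thus costs at most the delay at its size. The layers are
disjoint, there are at most `D` of them, and each has size at most `Δ`.
-/

noncomputable section

namespace RadioWakeUp

/-! ### Logarithms and the delay function -/

theorem one_le_lg (x : ℝ) : 1 ≤ lg x := le_max_left _ _

theorem lg_pos (x : ℝ) : 0 < lg x := one_pos.trans_le (one_le_lg x)

theorem logb_two_le (r : ℝ) (hr : 1 ≤ r) : Real.logb 2 r ≤ 1.45 * (r - 1) := by
  have h2 := Real.log_two_gt_d9
  have h1 := Real.log_le_sub_one_of_pos (zero_lt_one.trans_le hr)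
  rw [Real.logb, div_le_iff₀ (by linarith)]
  nlinarith

theorem lg_mono {x y : ℝ} (hx : 0 < x) (hxy : x ≤ y) : lg x ≤ lg y :=
  max_le_max le_rfl (Real.logb_le_logb_of_le (by norm_num) hx hxy)

theorem lg_natCast_mono {p q : ℕ} (h : p ≤ q) : lg p ≤ lg q := by
  rcases Nat.eq_zero_or_pos p with rfl | hp
  · simp [lg]
  · exact lg_mono (by exact_mod_cast hp) (by exact_mod_cast h)

theorem lg_le_self {x : ℝ} (hx : 1 ≤ x) : lg x ≤ x := by
  refine max_le hx ?_
  rw [Real.logb_le_iff_le_rpow (by norm_num) (by linarith)]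
  have := one_add_mul_self_le_rpow_one_add (s := 1) (by norm_num) hx
  norm_num at this
  linarith

theorem mul_lg_le {x y : ℝ} (hx : 0 < x) (hxy : x ≤ y) :
    x * lg y ≤ x * lg x + 1.45 * (y - x) := by
  have hr : 1 ≤ y / x := (one_le_div hx).2 hxy
  have hlog : Real.logb 2 y = Real.logb 2 x + Real.logb 2 (y / x) := by
    rw [← Real.logb_mul hx.ne' (by positivity), mul_div_cancel₀ _ hx.ne']
  have h1 : lg y ≤ lg x + 1.45 * (y / x - 1) := by
    have h := logb_two_le _ hr
    refine max_le ?_ ?_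
    · have := one_le_lg x
      linarith
    · have : Real.logb 2 x ≤ lg x := le_max_right _ _
      linarith
  calc x * lg y ≤ x * (lg x + 1.45 * (y / x - 1)) := by gcongr
    _ = x * lg x + 1.45 * (y - x) := by field_simp

/-- `lg x / lg (lg x)` is not monotone, but it is so up to a factor of two. -/
theorem lg_div_lg_lg_le {p q : ℕ} (h : p ≤ q) :
    lg p / lg (lg p) ≤ 2 * (lg q / lg (lg q)) := by
  have hxy := lg_natCast_mono h
  have h1 := mul_lg_le (lg_pos p) hxy
  have h2 := one_le_lg (lg p)
  have h3 := lg_pos (p : ℝ)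
  rw [← mul_div_assoc, div_le_div_iff₀ (lg_pos _) (lg_pos _)]
  nlinarith

/-- The growth rate `q lg q / lg (lg q)` of the delay function. -/
def rate (q : ℕ) : ℝ := q * lg q / lg (lg q)

theorem rate_mono : Monotone rate := by
  intro p q h
  rcases Nat.eq_zero_or_pos p with rfl | hp
  · have := lg_pos (q : ℝ)
    have := lg_pos (lg (q : ℝ))
    simp only [rate, Nat.cast_zero, zero_mul, zero_div]
    positivity
  have hp' : (1 : ℝ) ≤ p := by exact_mod_cast hp
  have hpq : (p : ℝ) ≤ q := by exact_mod_cast h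
  have hxy := lg_natCast_mono h
  have h1 := mul_lg_le (lg_pos p) hxy
  have h2 := one_le_lg (lg p)
  have h3 := one_le_lg (p : ℝ)
  have h4 : p * (lg q - lg p) ≤ 1.45 * (q - p : ℝ) := by
    linarith [mul_lg_le (by linarith) hpq]
  rw [rate, rate, div_le_div_iff₀ (lg_pos _) (lg_pos _)]
  have h5 : lg p * lg (lg q) ≤ lg q * lg (lg p) + 0.45 * (lg q - lg p) := by nlinarith
  have h6 : 1 ≤ lg q * lg (lg p) := by nlinarith
  have h7 : (p : ℝ) * (lg p * lg (lg q)) ≤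
      p * (lg q * lg (lg p)) + 0.45 * (p * (lg q - lg p)) := by nlinarith
  nlinarith

theorem delay_eq (c : ℝ) (n q : ℕ) : delay c n q = ⌈c * rate q * lg n⌉₊ := by
  rw [delay, rate]
  congr 1
  ring

theorem delay_mono {c : ℝ} (hc : 0 ≤ c) (n : ℕ) : Monotone (delay c n) := by
  intro p q h
  rw [delay_eq, delay_eq]
  have := rate_mono h
  have := lg_pos (n : ℝ)
  gcongr

/-! ### Executions -/

section Execution

variable {n : ℕ} {N : RadioNetwork n} {R : LocalRule n} {wake : Fin n → Option ℕ}

theorem activation_succ_of_some {t i : ℕ} {v : Fin n} (h : activation N R wake t v = some i) :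
    activation N R wake (t + 1) v = some i := by
  simp [activation, h]

theorem activation_mono {t t' i : ℕ} (htt' : t ≤ t') {v : Fin n}
    (h : activation N R wake t v = some i) : activation N R wake t' v = some i := by
  induction t', htt' using Nat.le_induction with
  | base => exact h
  | succ k _ ih => exact activation_succ_of_some ih

theorem isSome_activation_mono {t t' : ℕ} (htt' : t ≤ t') {v : Fin n}
    (h : (activation N R wake t v).isSome) : (activation N R wake t' v).isSome := by
  obtain ⟨i, hi⟩ := Option.isSome_iff_exists.1 h
  rw [activation_mono htt' hi]
  rfl

theorem le_of_activation {t i : ℕ} {v : Fin n} (h : activation N R wake t v = some i) :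
    i ≤ t := by
  induction t with
  | zero =>
    simp only [activation] at h
    split_ifs at h
    simp_all
  | succ t ih =>
    cases h' : activation N R wake t v with
    | some k =>
      rw [activation_succ_of_some h'] at h
      cases h
      exact (ih h').trans (Nat.le_succ t)
    | none =>
      simp only [activation, h'] at h
      split_ifs at h
      simp_all

/-- An active node was active ever since its activation time. -/
theorem activation_at_activation_time {t t' i : ℕ} {v : Fin n}
    (h : activation N R wake t v = some i) (hi : i ≤ t') :
    activation N R wake t' v = some i := by
  rcases le_total t t' with htt' | htt'
  · exact activation_mono htt' h
  · induction t, htt' using Nat.le_induction with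
    | base => exact h
    | succ k hk ih =>
      refine ih ?_
      cases h' : activation N R wake k v with
      | some l => rw [← h, activation_succ_of_some h']
      | none =>
        simp only [activation, h'] at h
        split_ifs at h
        simp only [Option.some.injEq] at h
        omega

theorem isSome_activation_of_wake {t : ℕ} {v : Fin n} (h : wake v = some t) :
    (activation N R wake t v).isSome := by
  cases t with
  | zero => simp [activation, h]
  | succ t =>
    simp only [activation, h, true_or, if_true]
    split <;> rfl

theorem isSome_activation_of_receives {t : ℕ} {v : Fin n}
    (h : Receives N R (activation N R wake t) t v) :
    (activation N R wake (t + 1) v).isSome := by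
  simp only [activation, h, or_true, if_true]
  split <;> rfl

theorem Transmits.isSome {act : Fin n → Option ℕ} {t : ℕ} {v : Fin n}
    (h : Transmits R act t v) : (act v).isSome := by
  obtain ⟨i, hi, -⟩ := h
  simp [hi]

end Execution

/-! ### Synchronizers wake up nodes -/

section Synchronized

variable {n m : ℕ} {N : RadioNetwork n} {S : SeqFamily n m} {wake : Fin n → Option ℕ}

/-- If the activation times are read off at time `T`, then before time `T` the columns of the
synchronizer are the transmissions of the algorithm. -/
theorem entry_eq_one_iff_transmits {T j : ℕ} (hj : j < T) (v : Fin n) :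
    entry S (fun v => (activation N (wakeUpAlgorithm S) wake T v).getD T) v j = 1 ↔
      Transmits (wakeUpAlgorithm S) (activation N (wakeUpAlgorithm S) wake j) j v := by
  cases h : activation N (wakeUpAlgorithm S) wake T v with
  | none =>
    have h1 : ¬ Transmits (wakeUpAlgorithm S) (activation N (wakeUpAlgorithm S) wake j) j v := by
      intro h'
      have := isSome_activation_mono hj.le h'.isSome
      simp [h] at this
    simp [entry, h1, h, hj.not_ge]
  | some i =>
    by_cases hij : i ≤ j
    · have h1 := activation_at_activation_time h hij
      by_cases hm : j - i < m
      · simp [entry, h, hij, hm, Transmits, h1, wakeUpAlgorithm, Bool.toNat_eq_one]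
      · simp [entry, h, hm, Transmits, wakeUpAlgorithm, h1]
    · have h1 : ¬ Transmits (wakeUpAlgorithm S) (activation N (wakeUpAlgorithm S) wake j) j v := by
        rintro ⟨k, hk, -⟩
        have h2 := activation_mono hj.le hk
        have h3 := le_of_activation hk
        rw [h] at h2
        cases h2
        exact hij h3
      simp [entry, h, h1, hij]

theorem existsUnique_of_sum_eq_one {ι : Type*} {X : Finset ι} {f : ι → ℕ}
    (h : ∑ v ∈ X, f v = 1) : ∃! v, v ∈ X ∧ f v = 1 := by
  classical
  obtain ⟨v, hv, hfv⟩ : ∃ v ∈ X, f v ≠ 0 := by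
    by_contra! h'
    rw [Finset.sum_eq_zero h'] at h
    exact zero_ne_one h
  rw [← Finset.add_sum_erase _ _ hv] at h
  refine ⟨v, ⟨hv, by omega⟩, fun u ⟨hu, hfu⟩ => ?_⟩
  by_contra huv
  have : f u ≤ ∑ x ∈ X.erase v, f x :=
    Finset.single_le_sum (fun _ _ => Nat.zero_le _) (Finset.mem_erase.2 ⟨huv, hu⟩)
  omega

/-- A set `X` of in-neighbors of `w`, one of which is active at time `t`, activates `w` before
`g |X|` more steps have passed, unless some other in-neighbor of `w` interferes. -/
theorem isSome_activation_of_synchronizer {g : ℕ → ℕ}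
    (hS : IsUniversalRadioSynchronizer n g S) {X : Finset (Fin n)} {w u : Fin n} {t : ℕ}
    (hX : ∀ v ∈ X, N.Adj v w) (hu : u ∈ X)
    (hut : (activation N (wakeUpAlgorithm S) wake t u).isSome)
    (hquiet : ∀ v, N.Adj v w → v ∉ X →
      ¬ (activation N (wakeUpAlgorithm S) wake (t + g X.card) v).isSome) :
    (activation N (wakeUpAlgorithm S) wake (t + g X.card) w).isSome := by
  set T := t + g X.card with hT
  set ω : Fin n → ℕ := fun v => (activation N (wakeUpAlgorithm S) wake T v).getD T with hω
  obtain ⟨i, hi⟩ := Option.isSome_iff_exists.1 hut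
  have hωu : ω u ≤ t := by
    have h1 := activation_mono (show t ≤ T by omega) hi
    have h2 := le_of_activation hi
    simpa [hω, h1] using h2
  obtain ⟨j, -, hj, hsum⟩ := hS.2 ω X ⟨u, hu⟩
  have hmin := Finset.inf'_le (s := X) ω hu
  have hjT : j < T := by omega
  obtain ⟨v, ⟨hv, hv1⟩, huniq⟩ := existsUnique_of_sum_eq_one hsum
  by_cases hw : Transmits (wakeUpAlgorithm S) (activation N (wakeUpAlgorithm S) wake j) j w
  · exact isSome_activation_mono hjT.le hw.isSome
  · refine isSome_activation_mono (show j + 1 ≤ T from hjT)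
      (isSome_activation_of_receives ⟨hw, v, ⟨hX v hv, (entry_eq_one_iff_transmits hjT v).1 hv1⟩,
        fun x ⟨hx, hxt⟩ => ?_⟩)
    by_cases hxX : x ∈ X
    · exact huniq x ⟨hxX, (entry_eq_one_iff_transmits hjT x).2 hxt⟩
    · exact absurd (isSome_activation_mono hjT.le hxt.isSome) (hquiet x hx hxX)

end Synchronized

/-! ### Layers of a walk -/

section Layers

variable {n : ℕ} (N : RadioNetwork n) (P : ℕ → Fin n) (d : ℕ)

open Classical in
/-- The last position on the walk `P 0, …, P d` to which `u` can send directly, where `P 0` does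
not count; it is `0` if there is none. -/
def lastOut (u : Fin n) : ℕ := ((Finset.Icc 1 d).filter fun i => N.Adj u (P i)).sup id

/-- The nodes that send to `P i` but not to a later node of the walk. -/
def layer (i : ℕ) : Finset (Fin n) := Finset.univ.filter fun u => lastOut N P d u = i

variable {N P d}

theorem lastOut_le (u : Fin n) : lastOut N P d u ≤ d := by
  classical
  exact Finset.sup_le fun i hi => (Finset.mem_Icc.1 (Finset.mem_filter.1 hi).1).2

theorem le_lastOut {u : Fin n} {i : ℕ} (h1 : 1 ≤ i) (hd : i ≤ d) (h : N.Adj u (P i)) :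
    i ≤ lastOut N P d u := by
  classical
  exact Finset.le_sup (f := id) (Finset.mem_filter.2 ⟨Finset.mem_Icc.2 ⟨h1, hd⟩, h⟩)

theorem adj_of_lastOut {u : Fin n} (h : lastOut N P d u ≠ 0) :
    N.Adj u (P (lastOut N P d u)) := by
  classical
  have hne : ((Finset.Icc 1 d).filter fun i => N.Adj u (P i)).Nonempty := by
    by_contra h'
    rw [Finset.not_nonempty_iff_eq_empty] at h'
    exact h (by simp [lastOut, h'])
  obtain ⟨i, hi, h'⟩ := Finset.exists_mem_eq_sup _ hne id
  have h2 : lastOut N P d u = i := h'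
  rw [h2]
  exact (Finset.mem_filter.1 hi).2

theorem card_layer_le {i : ℕ} (hi : i ≠ 0) : (layer N P d i).card ≤ N.maxInDegree := by
  classical
  refine le_trans (Finset.card_le_card ?_)
    (Finset.le_sup (f := fun v => N.inDegree v) (Finset.mem_univ (P i)))
  intro u hu
  have h := (Finset.mem_filter.1 hu).2
  refine Finset.mem_filter.2 ⟨Finset.mem_univ _, ?_⟩
  have := adj_of_lastOut (N := N) (P := P) (d := d) (u := u) (by rwa [h])
  rwa [h] at this

theorem sum_card_layer_le : ∑ i ∈ Finset.Icc 1 d, (layer N P d i).card ≤ n := by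
  have := Finset.card_eq_sum_card_fiberwise (f := lastOut N P d) (s := Finset.univ)
    (t := Finset.Icc 0 d) (fun u _ => by simp [lastOut_le])
  rw [Finset.card_univ, Fintype.card_fin] at this
  conv_rhs => rw [this]
  exact Finset.sum_le_sum_of_subset (Finset.Icc_subset_Icc_left (Nat.zero_le 1))

/-- The activity moves along the layers: layer `i` is left behind after `g |layer i|` steps. -/
theorem exists_active_beyond_layer {m : ℕ} {S : SeqFamily n m} {g : ℕ → ℕ}
    (hS : IsUniversalRadioSynchronizer n g S) {wake : Fin n → Option ℕ} {t₀ : ℕ}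
    (hP : ∀ i < d, N.Adj (P i) (P (i + 1)))
    (h0 : (activation N (wakeUpAlgorithm S) wake t₀ (P 0)).isSome) {i : ℕ} (hi : i ≤ d) :
    ∃ u, (activation N (wakeUpAlgorithm S) wake
      (t₀ + ∑ k ∈ Finset.Icc 1 i, g (layer N P d k).card) u).isSome ∧
      (i < lastOut N P d u ∨ u = P d) := by
  induction i with
  | zero =>
    refine ⟨P 0, by simpa using h0, ?_⟩
    rcases Nat.eq_zero_or_pos d with rfl | hd
    · exact Or.inr rfl
    · exact Or.inl (le_lastOut le_rfl hd (hP 0 hd))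
  | succ i ih =>
    -- If there is no activity beyond layer `i + 1`, then the active node `u` lies in that layer, and
    -- no in-neighbor of `P (i + 1)` outside the layer is active.
    obtain ⟨u, hu, hlast⟩ := ih (by omega)
    rw [Finset.sum_Icc_succ_top (by omega), ← add_assoc]
    set t := t₀ + ∑ k ∈ Finset.Icc 1 i, g (layer N P d k).card
    by_contra! hcon
    have hu' := hcon u (isSome_activation_mono (Nat.le_add_right _ _) hu)
    have hlu : lastOut N P d u = i + 1 := by
      have h1 := hlast.resolve_right hu'.2
      omega
    have hPi : (activation N (wakeUpAlgorithm S) wake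
        (t + g (layer N P d (i + 1)).card) (P (i + 1))).isSome := by
      refine isSome_activation_of_synchronizer hS (u := u) ?_ (by simp [layer, hlu]) hu ?_
      · intro v hv
        have h := (Finset.mem_filter.1 hv).2
        rw [← h]
        exact adj_of_lastOut (by omega)
      · intro v hv hvX hact
        have h1 := le_lastOut (by omega) hi hv
        have h2 := (hcon v hact).1
        exact hvX (by simp only [layer, Finset.mem_filter, Finset.mem_univ, true_and]; omega)
    have h1 := hcon _ hPi
    rcases hi.eq_or_lt with hd | hd
    · exact h1.2 (by rw [hd])
    · have := le_lastOut (by omega) hd (hP (i + 1) hd)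
      omega

theorem RadioNetwork.HasWalk.exists_path {k : ℕ} {u v : Fin n} (h : N.HasWalk k u v) :
    ∃ P : ℕ → Fin n, P 0 = u ∧ P k = v ∧ ∀ i < k, N.Adj (P i) (P (i + 1)) := by
  induction k generalizing v with
  | zero => exact ⟨fun _ => u, rfl, h, by simp⟩
  | succ k ih =>
    obtain ⟨w, hw, hwv⟩ := h
    obtain ⟨P, h0, hk, hadj⟩ := ih hw
    refine ⟨fun i => if i ≤ k then P i else v, by simpa using h0, by simp, fun i hi => ?_⟩
    rcases Nat.lt_succ_iff_lt_or_eq.1 hi with h | rfl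
    · simpa [h.le, Nat.succ_le_of_lt h] using hadj i h
    · simpa [hk] using hwv

theorem RadioNetwork.hasWalk_dist (u v : Fin n) : N.HasWalk (N.dist u v) u v := by
  refine Nat.sInf_mem (s := {k | N.HasWalk k u v}) ?_
  induction N.reachable u v with
  | refl => exact ⟨0, rfl⟩
  | tail _ hadj ih =>
    obtain ⟨k, hk⟩ := ih
    exact ⟨k + 1, _, hk, hadj⟩

end Layers

/-! ### The wake-up time -/

/-- The delay at `k ≤ Δ` is at most `k` times its value per node at `Δ`, up to a constant. -/
theorem delay_le {c : ℝ} (hc : 0 < c) (n : ℕ) {k Δ : ℕ} (hk : k ≤ Δ) :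
    (delay c n k : ℝ) ≤ (2 * c + 1) * k * (lg n * lg Δ / lg (lg Δ)) := by
  rcases Nat.eq_zero_or_pos k with rfl | hk0
  · simp [delay]
  have hk1 : (1 : ℝ) ≤ k := by exact_mod_cast hk0
  have hn := one_le_lg (n : ℝ)
  have hΔ : 1 ≤ lg Δ / lg (lg Δ) :=
    (one_le_div (lg_pos _)).2 (lg_le_self (one_le_lg _))
  have hpos : 0 ≤ c * k * lg k * lg n / lg (lg k) := by
    have := lg_pos (k : ℝ)
    have := lg_pos (lg (k : ℝ))
    positivity
  have h1 : c * k * lg k * lg n / lg (lg k) = c * k * lg n * (lg k / lg (lg k)) := by ring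
  have h2 : c * k * lg n * (lg k / lg (lg k)) ≤
      c * k * lg n * (2 * (lg Δ / lg (lg Δ))) := by
    have := lg_div_lg_lg_le hk
    gcongr
  have h3 : 1 ≤ k * (lg n * (lg Δ / lg (lg Δ))) :=
    one_le_mul_of_one_le_of_one_le hk1 (one_le_mul_of_one_le_of_one_le hn hΔ)
  calc (delay c n k : ℝ) ≤ c * k * lg k * lg n / lg (lg k) + 1 := (Nat.ceil_lt_add_one hpos).le
    _ ≤ c * k * lg n * (2 * (lg Δ / lg (lg Δ))) + k * (lg n * (lg Δ / lg (lg Δ))) := by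
      linarith
    _ = _ := by ring

/-- The layers of a shortest walk are disjoint, at most `ecc s` in number, and of size at most the
maximum in-degree; so their delays add up to the claimed time. -/
theorem wakesUpWithin_of_synchronizer {c : ℝ} (hc : 0 < c) {n : ℕ}
    {S : SeqFamily n (delay c n n)}
    (hS : IsUniversalRadioSynchronizer n (delay c n) S) (N : RadioNetwork n)
    {wake : Fin n → Option ℕ} {s : Fin n} {t₀ : ℕ} (hs : wake s = some t₀) :
    WakesUpWithin N (wakeUpAlgorithm S) wake t₀
      ((2 * c + 1) * (min (n : ℝ) ((N.ecc s : ℝ) * (N.maxInDegree : ℝ)) * lg n *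
        lg N.maxInDegree / lg (lg N.maxInDegree))) := by
  set Δ := N.maxInDegree
  set B := lg n * lg Δ / lg (lg Δ) with hB
  have hB0 : 0 ≤ B := by
    have := lg_pos (n : ℝ)
    have := lg_pos (Δ : ℝ)
    have := lg_pos (lg (Δ : ℝ))
    positivity
  have hT0 : 0 ≤ (2 * c + 1) * min (n : ℝ) ((N.ecc s : ℝ) * (Δ : ℝ)) * B := by positivity
  have hT : (2 * c + 1) * (min (n : ℝ) ((N.ecc s : ℝ) * (Δ : ℝ)) * lg n * lg Δ / lg (lg Δ)) =
      (2 * c + 1) * min (n : ℝ) ((N.ecc s : ℝ) * (Δ : ℝ)) * B := by rw [hB]; ring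
  rw [hT]
  refine ⟨_, Nat.floor_le hT0, fun v => ?_⟩
  obtain ⟨P, h0, hd, hP⟩ := (N.hasWalk_dist s v).exists_path
  have hecc : N.dist s v ≤ N.ecc s := Finset.le_sup (f := fun v => N.dist s v) (Finset.mem_univ v)
  set d := N.dist s v
  obtain ⟨u, hu, hlast⟩ := exists_active_beyond_layer hS (wake := wake) (t₀ := t₀) hP
    (by rw [h0]; exact isSome_activation_of_wake hs) le_rfl
  rcases hlast with h | rfl
  · exact absurd (lastOut_le u) h.not_ge
  rw [hd] at hu
  refine isSome_activation_mono (Nat.add_le_add_left (Nat.le_floor ?_) _) hu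
  have hcard : ((∑ k ∈ Finset.Icc 1 d, (layer N P d k).card : ℕ) : ℝ) ≤
      min (n : ℝ) ((N.ecc s : ℝ) * (Δ : ℝ)) := by
    refine le_min (by exact_mod_cast sum_card_layer_le) ?_
    have : ∑ k ∈ Finset.Icc 1 d, (layer N P d k).card ≤ d * Δ := by
      refine (Finset.sum_le_card_nsmul _ _ Δ fun k hk => card_layer_le ?_).trans ?_
      · have := Finset.mem_Icc.1 hk
        omega
      · simp
    exact_mod_cast this.trans (Nat.mul_le_mul_right _ hecc)
  calc ((∑ k ∈ Finset.Icc 1 d, delay c n (layer N P d k).card : ℕ) : ℝ)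
      ≤ ∑ k ∈ Finset.Icc 1 d, (2 * c + 1) * ((layer N P d k).card : ℝ) * B := by
        rw [Nat.cast_sum]
        refine Finset.sum_le_sum fun k hk => delay_le hc n (card_layer_le ?_)
        have := Finset.mem_Icc.1 hk
        omega
    _ = (2 * c + 1) * ((∑ k ∈ Finset.Icc 1 d, (layer N P d k).card : ℕ) : ℝ) * B := by
        rw [Nat.cast_sum, Finset.mul_sum, Finset.sum_mul]
    _ ≤ _ := by gcongr

/-! ### Independent random bits -/

section RandomBits

open MeasureTheory ProbabilityTheory

variable {ι : Type*} [Fintype ι]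

/-- The law of independent random bits, where bit `i` is `true` with probability `p i`. -/
def bitLaw (p : ι → unitInterval) : Measure (ι → Bool) :=
  Measure.pi fun i => bernoulliMeasure true false (p i)

instance (p : ι → unitInterval) : IsProbabilityMeasure (bitLaw p) := by
  unfold bitLaw
  infer_instance

theorem bitLaw_real_pattern (p : ι → unitInterval) (A : Finset ι) (b : ι → Bool) :
    (bitLaw p).real {x | ∀ i ∈ A, x i = b i} =
      ∏ i ∈ A, if b i then (p i : ℝ) else 1 - p i := by
  have h : {x : ι → Bool | ∀ i ∈ A, x i = b i} = (A : Set ι).pi fun i => {b i} := by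
    ext x
    simp [Set.mem_pi]
  rw [h, bitLaw, measureReal_def, Measure.pi_pi_finset, ENNReal.toReal_prod]
  refine Finset.prod_congr rfl fun i _ => ?_
  rw [← measureReal_def]
  cases hb : b i
  · simp
  · simp

theorem exp_neg_two_mul_le {p : ℝ} (h0 : 0 ≤ p) (h : p ≤ 1 / 2) : Real.exp (-(2 * p)) ≤ 1 - p := by
  have h1 : 0 < 1 - p := by linarith
  rw [Real.exp_neg, inv_le_comm₀ (Real.exp_pos _) h1]
  have h2 := Real.add_one_le_exp (2 * p)
  refine le_trans ?_ h2
  rw [inv_le_iff_one_le_mul₀ h1]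
  nlinarith

/-- Exactly one of the bits in `A` is `true` with probability at least `f e ^ (-2 f)`, where `f`
is the expected number of `true` bits in `A`. -/
theorem le_bitLaw_real_sum_eq_one {p : ι → unitInterval} (hp : ∀ i, (p i : ℝ) ≤ 1 / 2)
    (A : Finset ι) :
    (∑ i ∈ A, (p i : ℝ)) * Real.exp (-(2 * ∑ i ∈ A, (p i : ℝ))) ≤
      (bitLaw p).real {x | ∑ i ∈ A, (x i).toNat = 1} := by
  classical
  set E : ι → Set (ι → Bool) := fun i => {x | ∀ k ∈ A, x k = decide (k = i)} with hE
  have hdisj : Set.PairwiseDisjoint (A : Set ι) E := by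
    intro i hi k _ hik
    refine Set.disjoint_left.2 fun x hx hx' => hik ?_
    have h1 := hx i hi
    have h2 := hx' i hi
    simpa [h1] using h2
  have hsub : (⋃ i ∈ A, E i) ⊆ {x | ∑ i ∈ A, (x i).toNat = 1} := by
    intro x hx
    obtain ⟨i, hi, hxi⟩ := Set.mem_iUnion₂.1 hx
    change ∑ k ∈ A, (x k).toNat = 1
    rw [Finset.sum_congr rfl fun k hk => by rw [hxi k hk], Finset.sum_eq_single_of_mem i hi]
    · simp
    · intro k _ hki
      simp [hki]
  refine le_trans ?_ (measureReal_mono hsub)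
  rw [measureReal_biUnion_finset hdisj (fun i _ => MeasurableSet.of_discrete), Finset.sum_mul]
  refine Finset.sum_le_sum fun i hi => ?_
  rw [hE, bitLaw_real_pattern, ← Finset.mul_prod_erase _ _ hi]
  simp only [decide_true, if_true]
  refine mul_le_mul_of_nonneg_left ?_ (p i).2.1
  calc Real.exp (-(2 * ∑ i ∈ A, (p i : ℝ))) ≤ Real.exp (∑ k ∈ A.erase i, -(2 * (p k : ℝ))) := by
        rw [Real.exp_le_exp, Finset.sum_neg_distrib, ← Finset.mul_sum, neg_le_neg_iff]
        have := Finset.sum_le_sum_of_subset_of_nonneg (f := fun i => (p i : ℝ))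
          (Finset.erase_subset i A) (fun k _ _ => (p k).2.1)
        linarith
    _ = ∏ k ∈ A.erase i, Real.exp (-(2 * (p k : ℝ))) := Real.exp_sum _ _
    _ ≤ _ := by
        refine Finset.prod_le_prod (fun _ _ => (Real.exp_pos _).le) fun k hk => ?_
        simpa [Finset.ne_of_mem_erase hk] using exp_neg_two_mul_le (p k).2.1 (hp k)

theorem bitLaw_real_inter (p : ι → unitInterval) {A B : Finset ι} (hAB : Disjoint A B)
    {E F : Set (ι → Bool)} (hE : DependsOn (· ∈ E) (A : Set ι))
    (hF : DependsOn (· ∈ F) (B : Set ι)) :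
    (bitLaw p).real (E ∩ F) = (bitLaw p).real E * (bitLaw p).real F := by
  have hind : iIndepFun (fun i (x : ι → Bool) => x i) (bitLaw p) :=
    iIndepFun_pi (X := fun _ => id) fun _ => aemeasurable_id
  have h := hind.indepFun_finset A B hAB fun i => measurable_pi_apply i
  have key : ∀ {A : Finset ι} {E : Set (ι → Bool)}, DependsOn (· ∈ E) (A : Set ι) →
      E = (fun (x : ι → Bool) (i : A) => x i) ⁻¹' ((fun (x : ι → Bool) (i : A) => x i) '' E) := by
    intro A E hE
    refine (Set.subset_preimage_image _ _).antisymm ?_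
    rintro x ⟨y, hy, hyx⟩
    exact (hE fun i hi => congrFun hyx ⟨i, hi⟩).mp hy
  have := h.measure_inter_preimage_eq_mul _ _
    (MeasurableSet.of_discrete (s := (fun (x : ι → Bool) (i : A) => x i) '' E))
    (MeasurableSet.of_discrete (s := (fun (x : ι → Bool) (i : B) => x i) '' F))
  rw [← key hE, ← key hF] at this
  simp only [measureReal_def, this, ENNReal.toReal_mul]

/-- The probability that none of several disjoint sets `A j` of bits contains exactly one `true`
bit. -/
theorem bitLaw_real_forall_ne_one_le {p : ι → unitInterval} (hp : ∀ i, (p i : ℝ) ≤ 1 / 2)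
    {κ : Type*} (J : Finset κ) {A : κ → Finset ι}
    (hA : Pairwise fun j k => Disjoint (A j) (A k)) :
    (bitLaw p).real {x | ∀ j ∈ J, ∑ i ∈ A j, (x i).toNat ≠ 1} ≤
      Real.exp (-∑ j ∈ J, (∑ i ∈ A j, (p i : ℝ)) * Real.exp (-(2 * ∑ i ∈ A j, (p i : ℝ)))) := by
  classical
  induction J using Finset.induction_on with
  | empty => simp
  | insert j J hj ih =>
    have hset : {x : ι → Bool | ∀ k ∈ insert j J, ∑ i ∈ A k, (x i).toNat ≠ 1} =
        {x | ∑ i ∈ A j, (x i).toNat ≠ 1} ∩ {x | ∀ k ∈ J, ∑ i ∈ A k, (x i).toNat ≠ 1} := by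
      ext x
      simp
    rw [hset, bitLaw_real_inter p (A := A j) (B := J.biUnion A), Finset.sum_insert hj, neg_add,
      Real.exp_add]
    · refine mul_le_mul ?_ ih measureReal_nonneg (Real.exp_pos _).le
      have hcompl : {x : ι → Bool | ∑ i ∈ A j, (x i).toNat ≠ 1} =
          {x | ∑ i ∈ A j, (x i).toNat = 1}ᶜ := rfl
      rw [hcompl, probReal_compl_eq_one_sub MeasurableSet.of_discrete]
      refine le_trans ?_ (Real.one_sub_le_exp_neg _)
      linarith [le_bitLaw_real_sum_eq_one hp (A j)]
    · refine (Finset.disjoint_biUnion_right _ _ _).2 fun k hk => hA ?_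
      rintro rfl
      exact hj hk
    · intro x y hxy
      simp only [Set.mem_ofPred_eq, ne_eq, eq_iff_iff]
      rw [Finset.sum_congr rfl fun i hi => by rw [hxy i hi]]
    · intro x y hxy
      simp only [Set.mem_ofPred_eq, ne_eq, eq_iff_iff]
      refine forall₂_congr fun k hk => ?_
      rw [Finset.sum_congr rfl fun i hi => by
        rw [hxy i (Finset.mem_coe.2 (Finset.mem_biUnion.2 ⟨k, hk, hi⟩))]]

end RandomBits

/-! ### Critical schedules -/

section Critical

variable {n m : ℕ}

/-- An activation schedule on `X` in which more nodes are activated before the time window of those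
activated so far is over, until all nodes of `X` are active. (If `g 0 = 0`, the case `j = 0` says that
some node is activated at time `0`.) -/
def IsCritical (g : ℕ → ℕ) (X : Finset (Fin n)) (ω : Fin n → ℕ) : Prop :=
  X.Nonempty ∧ ∀ j, (∃ v ∈ X, j < ω v) → j + 2 ≤ g (X.filter fun v => ω v ≤ j).card

theorem entry_of_lt {S : SeqFamily n m} {ω : Fin n → ℕ} {v : Fin n} {j : ℕ} (h : j < ω v) :
    entry S ω v j = 0 := by
  simp [entry, h.not_ge]

/-- It is enough to hit the critical schedules: a smallest set that is not hit is critical. -/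
theorem isUniversalRadioSynchronizer_of_critical {g : ℕ → ℕ} (hg : Monotone g)
    {S : SeqFamily n m}
    (h : ∀ (X : Finset (Fin n)) (ω : Fin n → ℕ), IsCritical g X ω →
      ∃ j < g X.card, ∑ v ∈ X, entry S ω v j = 1) :
    IsUniversalRadioSynchronizer n g S := by
  refine ⟨hg.monotoneOn _, fun ω₀ X₀ hX₀ => ?_⟩
  set μ := X₀.inf' hX₀ ω₀ with hμ
  set ω : Fin n → ℕ := fun v => ω₀ v - μ with hω
  have key : ∀ k, ∀ X ⊆ X₀, X.card = k → (∃ v ∈ X, ω v = 0) →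
      ∃ j < g X.card, ∑ v ∈ X, entry S ω v j = 1 := by
    intro k
    induction k using Nat.strong_induction_on with
    | _ k ih =>
      intro X hX hk hX0
      by_contra hfail
      refine hfail (h X ω ⟨hX0.imp fun v hv => hv.1, fun j ⟨w, hw, hjw⟩ => ?_⟩)
      by_contra! hj
      have hsub : X.filter (fun v => ω v ≤ j) ⊂ X :=
        Finset.filter_ssubset.2 ⟨w, hw, hjw.not_ge⟩
      obtain ⟨v, hv, hv0⟩ := hX0
      obtain ⟨i, hi, hsum⟩ := ih _ (hk ▸ Finset.card_lt_card hsub) _ (hsub.subset.trans hX) rfl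
        ⟨v, Finset.mem_filter.2 ⟨hv, by omega⟩, hv0⟩
      refine hfail ⟨i, hi.trans_le (hg (Finset.card_le_card hsub.subset)), ?_⟩
      rw [← hsum, Finset.sum_filter]
      refine Finset.sum_congr rfl fun u _ => ?_
      split_ifs with hu
      · rfl
      · exact entry_of_lt (by omega)
  obtain ⟨u, hu, huμ⟩ := Finset.exists_mem_eq_inf' hX₀ ω₀
  obtain ⟨j, hj, hsum⟩ := key _ X₀ subset_rfl rfl ⟨u, hu, by simp only [hω]; omega⟩
  refine ⟨μ + j, Nat.le_add_right _ _, Nat.add_lt_add_left hj _, ?_⟩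
  rw [← hsum]
  refine Finset.sum_congr rfl fun v hv => ?_
  have hv' : μ ≤ ω₀ v := Finset.inf'_le _ hv
  have h1 : μ + j - ω₀ v = j - ω v := by simp only [hω]; omega
  have h2 : ω₀ v ≤ μ + j ↔ ω v ≤ j := by simp only [hω]; omega
  simp only [entry, h1, h2]

theorem IsCritical.lt {g : ℕ → ℕ} (hg : Monotone g) (hg1 : 0 < g 1) {X : Finset (Fin n)}
    {ω : Fin n → ℕ} (h : IsCritical g X ω) {v : Fin n} (hv : v ∈ X) : ω v < g X.card := by
  rcases Nat.eq_zero_or_pos (ω v) with h0 | h0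
  · rw [h0]
    exact hg1.trans_le (hg h.1.card_pos)
  · have h1 := h.2 (ω v - 1) ⟨v, hv, by omega⟩
    have h2 := hg (Finset.card_filter_le X fun u => ω u ≤ ω v - 1)
    omega

end Critical

/-! ### The density of the random sequences -/

section Density

/-- The probability of a `true` entry at position `t` of the random sequences; `a` is of the order
of `lg n`. -/
def density (a : ℝ) (t : ℕ) : ℝ := a / (t + 2 * a)

variable {a : ℝ}

theorem density_nonneg (ha : 0 < a) (t : ℕ) : 0 ≤ density a t := by
  unfold density
  positivity

theorem density_le_half (ha : 0 < a) (t : ℕ) : density a t ≤ 1 / 2 := by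
  have : (0 : ℝ) ≤ t := Nat.cast_nonneg t
  rw [density, div_le_div_iff₀ (by positivity) (by norm_num)]
  linarith

theorem density_anti (ha : 0 < a) {s t : ℕ} (h : s ≤ t) : density a t ≤ density a s := by
  have : (s : ℝ) ≤ t := by exact_mod_cast h
  unfold density
  gcongr

theorem sum_density_le (ha : 1 ≤ a) (k : ℕ) :
    ∑ t ∈ Finset.range k, density a t ≤ a * Real.log ((k + 2 * a) / a) := by
  have h1 : ∑ t ∈ Finset.range k, density a t ≤
      a * (Real.log (k + 2 * a - 1) - Real.log (2 * a - 1)) := by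
    induction k with
    | zero => simp
    | succ k ih =>
      have hk : (0 : ℝ) ≤ k := Nat.cast_nonneg k
      have hpos : 0 < k + 2 * a - 1 := by linarith
      have hpos' : 0 < k + 2 * a := by linarith
      have hlog := Real.one_sub_inv_le_log_of_pos (div_pos hpos' hpos)
      rw [Real.log_div hpos'.ne' hpos.ne', inv_div] at hlog
      have he : 1 - (k + 2 * a - 1) / (k + 2 * a) = 1 / (k + 2 * a) := by
        field_simp
        ring
      rw [he] at hlog
      have hmul := mul_le_mul_of_nonneg_left hlog (show 0 ≤ a by linarith)
      have hcast : ((k + 1 : ℕ) : ℝ) + 2 * a - 1 = k + 2 * a := by push_cast; ring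
      rw [Finset.sum_range_succ, hcast, density, div_eq_mul_one_div]
      linarith
  have hk : (0 : ℝ) ≤ k := Nat.cast_nonneg k
  refine h1.trans (mul_le_mul_of_nonneg_left ?_ (by linarith))
  rw [Real.log_div (by linarith) (by linarith)]
  have h2 : Real.log (k + 2 * a - 1) ≤ Real.log (k + 2 * a) :=
    Real.log_le_log (by linarith) (by linarith)
  have h3 : Real.log a ≤ Real.log (2 * a - 1) := Real.log_le_log (by linarith) (by linarith)
  linarith

theorem log_le_lg {x : ℝ} (hx : 1 ≤ x) : Real.log x ≤ lg x := by
  refine le_trans ?_ (le_max_right _ _)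
  rw [Real.logb, le_div_iff₀ (Real.log_pos (by norm_num))]
  have := Real.log_two_lt_d9
  have := Real.log_nonneg hx
  nlinarith

theorem one_le_rate {q : ℕ} (hq : 1 ≤ q) : 1 ≤ rate q := by
  have hq' : (1 : ℝ) ≤ q := by exact_mod_cast hq
  rw [rate, mul_div_assoc]
  exact one_le_mul_of_one_le_of_one_le hq'
    ((one_le_div (lg_pos _)).2 (lg_le_self (one_le_lg _)))

theorem rate_le_sq {q : ℕ} (hq : 1 ≤ q) : rate q ≤ (q : ℝ) ^ 2 := by
  have hq' : (1 : ℝ) ≤ q := by exact_mod_cast hq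
  have h1 := lg_le_self hq'
  have h2 := lg_pos (q : ℝ)
  calc rate q ≤ q * lg q := div_le_self (by positivity) (one_le_lg _)
    _ ≤ q * q := by gcongr
    _ = _ := (sq _).symm

/-- The expected number of `true` entries in the first `4096 a rate q` positions of one sequence. -/
theorem sum_density_window_le (ha : 1 ≤ a) {q k : ℕ} (hq : 1 ≤ q)
    (hk : (k : ℝ) ≤ 4096 * a * rate q + 1) :
    ∑ t ∈ Finset.range k, density a t ≤ 15 * a * lg q := by
  have hq' : (1 : ℝ) ≤ q := by exact_mod_cast hq
  have hr := one_le_rate hq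
  have hr2 := rate_le_sq hq
  have hk0 : (0 : ℝ) ≤ k := Nat.cast_nonneg k
  have h1 : (k + 2 * a) / a ≤ 2 ^ 13 * (q : ℝ) ^ 2 := by
    rw [div_le_iff₀ (by linarith)]
    nlinarith
  have h2 : Real.log ((k + 2 * a) / a) ≤ 15 * lg q := by
    refine (Real.log_le_log (by positivity) h1).trans ?_
    rw [Real.log_mul (by norm_num) (by positivity), Real.log_pow, Real.log_pow]
    have := Real.log_two_lt_d9
    have := log_le_lg hq'
    have := one_le_lg (q : ℝ)
    push_cast
    linarith
  calc _ ≤ a * Real.log ((k + 2 * a) / a) := sum_density_le ha k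
    _ ≤ a * (15 * lg q) := by gcongr
    _ = _ := by ring

end Density

/-! ### The load of a column -/

section Load

variable {n : ℕ} {a : ℝ} {X : Finset (Fin n)} {ω : Fin n → ℕ}

/-- The expected number of `true` entries in column `j`. -/
def load (a : ℝ) (X : Finset (Fin n)) (ω : Fin n → ℕ) (j : ℕ) : ℝ :=
  ∑ v ∈ X, if ω v ≤ j then density a (j - ω v) else 0

theorem load_nonneg (ha : 0 < a) (j : ℕ) : 0 ≤ load a X ω j := by
  refine Finset.sum_nonneg fun v _ => ?_
  split_ifs
  · exact density_nonneg ha _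
  · exact le_rfl

theorem sum_load_le (ha : 0 < a) (k : ℕ) :
    ∑ j ∈ Finset.range k, load a X ω j ≤ X.card * ∑ t ∈ Finset.range k, density a t := by
  unfold load
  rw [Finset.sum_comm, ← nsmul_eq_mul]
  refine Finset.sum_le_card_nsmul _ _ _ fun v _ => ?_
  rw [← Finset.sum_filter]
  have hinj : Set.InjOn (fun j => j - ω v) ((Finset.range k).filter fun j => ω v ≤ j) := by
    intro i hi j hj hij
    have h1 := (Finset.mem_filter.1 hi).2
    have h2 := (Finset.mem_filter.1 hj).2
    simp only at hij
    omega
  rw [← Finset.sum_image (f := density a) hinj]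
  refine Finset.sum_le_sum_of_subset_of_nonneg ?_ fun t _ _ => density_nonneg ha t
  intro t ht
  obtain ⟨j, hj, rfl⟩ := Finset.mem_image.1 ht
  have := Finset.mem_range.1 (Finset.mem_filter.1 hj).1
  exact Finset.mem_range.2 (by omega)

/-- In a critical schedule, at least about `j / (4096 a)` divided by `lg q / lg (lg q)` nodes are active in
column `j`, and none of them is older than `j`. -/
theorem IsCritical.le_load (ha : 0 < a) {g : ℕ → ℕ}
    (hg : ∀ q, g q = ⌈4096 * a * rate q⌉₊) (h : IsCritical g X ω) {j : ℕ} (hj : j < g X.card)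
    (hja : 2 * a ≤ j) :
    lg (lg X.card) / (16384 * lg X.card) ≤ load a X ω j := by
  set Y := X.filter fun v => ω v ≤ j with hY
  have hjY : j < g Y.card := by
    by_cases hall : ∃ v ∈ X, j < ω v
    · have := h.2 j hall
      rw [← hY] at this
      omega
    · have : Y = X := Finset.filter_true_of_mem fun v hv => by
        by_contra hv'
        exact hall ⟨v, hv, by omega⟩
      rwa [this]
  have hYX : Y.card ≤ X.card := Finset.card_filter_le _ _
  rw [hg, Nat.lt_ceil] at hjY
  have hload : Y.card * density a j ≤ load a X ω j := by
    rw [load, ← Finset.sum_filter, ← nsmul_eq_mul]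
    exact Finset.card_nsmul_le_sum _ _ _ fun v _ => density_anti ha (Nat.sub_le _ _)
  refine le_trans ?_ hload
  have h1 := lg_div_lg_lg_le hYX
  set x := lg X.card with hx
  set z := lg x with hz
  have hx0 : 0 < x := lg_pos _
  have hz0 : 0 < z := lg_pos _
  have hj0 : (0 : ℝ) < j := by linarith
  have h2 : (j : ℝ) ≤ 4096 * a * (Y.card * (2 * (x / z))) := by
    refine hjY.le.trans ?_
    rw [rate, mul_div_assoc]
    gcongr
  have h3 : 1 / 2 * a / j ≤ density a j := by
    rw [density, div_le_div_iff₀ hj0 (by positivity)]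
    nlinarith
  calc z / (16384 * x) ≤ Y.card * (1 / 2 * a / j) := by
        rw [div_le_iff₀ (by positivity)]
        have h4 : z * j ≤ 8192 * a * Y.card * x := by
          calc z * j ≤ z * (4096 * a * (Y.card * (2 * (x / z)))) := by gcongr
            _ = 8192 * a * Y.card * x := by field_simp; ring
        have h5 : Y.card * (1 / 2 * a / j) * (16384 * x) = 8192 * a * Y.card * x / j := by ring
        rw [h5, le_div_iff₀ hj0]
        exact h4
    _ ≤ Y.card * density a j := by gcongr

/-- A lower bound for `f e ^ (-2 f)` that is linear in `f`, valid as soon as `f` is not too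
small. -/
theorem mul_exp_ge {x f : ℝ} (hx : 1 ≤ x) (hf : lg x / (16384 * x) ≤ f) :
    lg x / (131072 * x) * (1 - 8 * f / lg x) ≤ f * Real.exp (-(2 * f)) := by
  have hz := one_le_lg x
  have hz0 := lg_pos x
  have hf0 : 0 < f := lt_of_lt_of_le (by positivity) hf
  have hc : lg x / (131072 * x) = lg x / (16384 * x) / 8 := by
    field_simp
    norm_num
  rcases le_or_gt (lg x) (8 * f) with h1 | h1
  · have : 1 - 8 * f / lg x ≤ 0 := by
      rw [sub_nonpos, one_le_div hz0]
      exact h1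
    exact (mul_nonpos_of_nonneg_of_nonpos (by positivity) this).trans (by positivity)
  have h2 : lg x / (131072 * x) * (1 - 8 * f / lg x) ≤ lg x / (131072 * x) := by
    refine mul_le_of_le_one_right (by positivity) ?_
    have : 0 ≤ 8 * f / lg x := by positivity
    linarith
  refine h2.trans ?_
  rcases le_or_gt f 1 with h3 | h3
  · have he : 1 / 8 ≤ Real.exp (-(2 * f)) := by
      have h4 : Real.exp (-(2 : ℝ)) ≤ Real.exp (-(2 * f)) := Real.exp_le_exp.2 (by linarith)
      have h5 : Real.exp 2 = Real.exp 1 ^ 2 := by rw [← Real.exp_nat_mul]; norm_num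
      have h6 := Real.exp_one_lt_d9
      have h7 := Real.exp_pos 1
      refine le_trans ?_ h4
      rw [Real.exp_neg, h5, one_div]
      exact inv_anti₀ (by positivity) (by nlinarith)
    rw [hc, div_eq_mul_one_div]
    gcongr
  · -- Here `lg x > 8`, so that `x = 2 ^ lg x` is much larger than `lg x * exp (lg x / 4)`.
    have hlog : lg x / 2 ≤ Real.log x := by
      have h4 : lg x = Real.logb 2 x := by
        rcases max_choice 1 (Real.logb 2 x) with h5 | h5
        · rw [lg, h5] at h1
          linarith
        · exact h5
      rw [h4, Real.logb]
      have h5 := Real.log_two_gt_d9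
      have h6 := Real.log_nonneg hx
      rw [div_div, div_le_iff₀ (by linarith)]
      nlinarith
    have hxe : Real.exp (lg x / 4) * Real.exp (lg x / 4) ≤ x := by
      rw [← Real.exp_add, ← Real.le_log_iff_exp_le (by linarith)]
      linarith
    have hz4 : lg x / 4 ≤ Real.exp (lg x / 4) := by
      linarith [Real.add_one_le_exp (lg x / 4)]
    have he : Real.exp (-(lg x / 4)) ≤ f * Real.exp (-(2 * f)) := by
      calc Real.exp (-(lg x / 4)) ≤ 1 * Real.exp (-(2 * f)) := by
            rw [one_mul]
            exact Real.exp_le_exp.2 (by linarith)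
        _ ≤ _ := by gcongr
    refine le_trans ?_ he
    rw [Real.exp_neg, ← one_div, div_le_div_iff₀ (by positivity) (Real.exp_pos _)]
    have := Real.exp_pos (lg x / 4)
    nlinarith

/-- The expected number of columns with a single `true` entry, up to a constant. -/
theorem IsCritical.le_sum_load_mul_exp (ha : 1 ≤ a) {g : ℕ → ℕ}
    (hg : ∀ q, g q = ⌈4096 * a * rate q⌉₊) (h : IsCritical g X ω) :
    a * X.card / 64 ≤ ∑ j ∈ Finset.range (g X.card),
      load a X ω j * Real.exp (-(2 * load a X ω j)) := by
  set q := X.card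
  have hq : 1 ≤ q := h.1.card_pos
  have ha0 : 0 < a := by linarith
  have hr := one_le_rate hq
  have hG0 : 0 ≤ 4096 * a * rate q := by positivity
  have hgq : (g q : ℝ) ≤ 4096 * a * rate q + 1 := by
    rw [hg]
    exact (Nat.ceil_lt_add_one hG0).le
  have hgq' : 4096 * a * rate q ≤ g q := by
    rw [hg]
    exact Nat.le_ceil _
  set x := lg (q : ℝ) with hx
  have hx1 : 1 ≤ x := one_le_lg _
  have hz0 : 0 < lg x := lg_pos _
  set b := lg x / (131072 * x) with hb
  have hb0 : 0 ≤ b := by positivity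
  set I := Finset.Ico ⌈2 * a⌉₊ (g q) with hI
  have hIsub : I ⊆ Finset.range (g q) := by
    intro j hj
    exact Finset.mem_range.2 (Finset.mem_Ico.1 hj).2
  have hsum : ∑ j ∈ I, load a X ω j ≤ q * (15 * a * x) :=
    calc ∑ j ∈ I, load a X ω j ≤ ∑ j ∈ Finset.range (g q), load a X ω j :=
          Finset.sum_le_sum_of_subset_of_nonneg hIsub fun j _ _ => load_nonneg ha0 j
      _ ≤ q * ∑ t ∈ Finset.range (g q), density a t := sum_load_le ha0 _
      _ ≤ q * (15 * a * x) := by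
          gcongr
          exact sum_density_window_le ha hq hgq
  have hceil : (⌈2 * a⌉₊ : ℝ) < 2 * a + 1 := Nat.ceil_lt_add_one (by positivity)
  have hle : ⌈2 * a⌉₊ ≤ g q := by
    have : (⌈2 * a⌉₊ : ℝ) ≤ g q := by nlinarith
    exact_mod_cast this
  have hIcard : (I.card : ℝ) = g q - ⌈2 * a⌉₊ := by
    rw [hI, Nat.card_Ico, Nat.cast_sub hle]
  have hrate : q * (15 * a * x) * 8 / lg x = 120 * a * rate q := by
    rw [rate]
    ring
  calc a * q / 64 = b * (2048 * a * rate q) := by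
        rw [hb, rate, ← hx]
        field_simp
        norm_num
    _ ≤ b * (I.card - q * (15 * a * x) * 8 / lg x) := by
        refine mul_le_mul_of_nonneg_left ?_ hb0
        rw [hIcard, hrate]
        nlinarith
    -- Since the bound on each column is linear in its load, only the total load matters.
    _ ≤ b * (I.card - (∑ j ∈ I, load a X ω j) * 8 / lg x) := by gcongr
    _ = ∑ j ∈ I, b * (1 - 8 * load a X ω j / lg x) := by
        rw [← Finset.mul_sum, Finset.sum_sub_distrib, ← Finset.sum_div, ← Finset.mul_sum]
        simp [mul_comm]
    _ ≤ ∑ j ∈ I, load a X ω j * Real.exp (-(2 * load a X ω j)) := by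
        refine Finset.sum_le_sum fun j hj => mul_exp_ge hx1 ?_
        obtain ⟨hj1, hj2⟩ := Finset.mem_Ico.1 hj
        exact h.le_load ha0 hg hj2 (Nat.ceil_le.1 hj1)
    _ ≤ _ := Finset.sum_le_sum_of_subset_of_nonneg hIsub fun j _ _ =>
        mul_nonneg (load_nonneg ha0 j) (Real.exp_pos _).le

end Load

/-! ### Existence of synchronizers -/

section Existence

open MeasureTheory

variable {n m : ℕ}

/-- The entries of the sequences that are read in column `j`. -/
def cells (m : ℕ) (X : Finset (Fin n)) (ω : Fin n → ℕ) (j : ℕ) : Finset (Fin n × Fin m) :=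
  Finset.univ.filter fun i => i.1 ∈ X ∧ ω i.1 + i.2 = j

theorem pairwise_disjoint_cells (X : Finset (Fin n)) (ω : Fin n → ℕ) :
    Pairwise fun j k => Disjoint (cells m X ω j) (cells m X ω k) := by
  intro j k hjk
  refine Finset.disjoint_left.2 fun i hi hi' => hjk ?_
  rw [← (Finset.mem_filter.1 hi).2.2, ← (Finset.mem_filter.1 hi').2.2]

theorem sum_cells {M : Type*} [AddCommMonoid M] (X : Finset (Fin n)) (ω : Fin n → ℕ) (j : ℕ)
    (F : Fin n × Fin m → M) :
    ∑ i ∈ cells m X ω j, F i = ∑ v ∈ X,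
      if h : ω v ≤ j ∧ j - ω v < m then F (v, ⟨j - ω v, h.2⟩) else 0 := by
  rw [cells, Finset.sum_filter, Fintype.sum_prod_type, ← Finset.sum_subset (Finset.subset_univ X)]
  · refine Finset.sum_congr rfl fun v hv => ?_
    split_ifs with h
    · rw [Finset.sum_eq_single ⟨j - ω v, h.2⟩]
      · rw [if_pos ⟨hv, by simp only; omega⟩]
      · intro t _ ht
        refine if_neg fun h' => ht (Fin.ext ?_)
        have := h'.2
        simp only at this ⊢
        omega
      · simp
    · refine Finset.sum_eq_zero fun t _ => if_neg fun h' => h ?_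
      have := h'.2
      have := t.2
      simp only at *
      omega
  · intro v _ hv
    simp [hv]

/-- The nodes that take part in the schedule encoded by `σ`: those with `σ v ≠ none`. Set and
activation times are put into one function `σ` so that the union bound becomes a sum of
products. -/
def participants {M : ℕ} (σ : Fin n → Option (Fin M)) : Finset (Fin n) :=
  Finset.univ.filter fun v => (σ v).isSome

/-- The activation times encoded by `σ`, with junk value `0` for nodes that do not take part. -/
def times {M : ℕ} (σ : Fin n → Option (Fin M)) (v : Fin n) : ℕ := ((σ v).map Fin.val).getD 0

theorem exists_code {M : ℕ} {X : Finset (Fin n)} {ω : Fin n → ℕ} (h : ∀ v ∈ X, ω v < M) :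
    ∃ σ : Fin n → Option (Fin M), participants σ = X ∧ ∀ v ∈ X, times σ v = ω v := by
  classical
  refine ⟨fun v => if hv : v ∈ X then some ⟨ω v, h v hv⟩ else none, ?_, fun v hv => ?_⟩
  · ext v
    by_cases hv : v ∈ X <;> simp [participants, hv]
  · simp [times, hv]

theorem sum_pow_card_participants (M : ℕ) (y : ℝ) :
    ∑ σ : Fin n → Option (Fin M), y ^ (participants σ).card = (1 + M * y) ^ n := by
  have h1 : ∀ σ : Fin n → Option (Fin M),
      y ^ (participants σ).card = ∏ v, if (σ v).isSome then y else 1 := by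
    intro σ
    rw [Finset.prod_ite, Finset.prod_const, Finset.prod_const_one, mul_one, participants]
  simp_rw [h1]
  rw [← Fintype.prod_sum fun (_ : Fin n) (o : Option (Fin M)) => if o.isSome then y else 1]
  simp [Fintype.sum_option]

theorem IsCritical.congr {g : ℕ → ℕ} {X : Finset (Fin n)} {ω ω' : Fin n → ℕ}
    (h : IsCritical g X ω) (hω : ∀ v ∈ X, ω' v = ω v) : IsCritical g X ω' := by
  refine ⟨h.1, fun j ⟨v, hv, hj⟩ => ?_⟩
  rw [Finset.filter_congr fun u hu => by rw [hω u hu]]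
  exact h.2 j ⟨v, hv, by rwa [← hω v hv]⟩

/-- A random family misses a given critical schedule with small probability. -/
theorem IsCritical.bitLaw_real_le {a : ℝ} (ha : 1 ≤ a) {g : ℕ → ℕ}
    (hg : ∀ q, g q = ⌈4096 * a * rate q⌉₊) {p : Fin n × Fin m → unitInterval}
    (hp : ∀ i, (p i : ℝ) = density a i.2) {X : Finset (Fin n)} {ω : Fin n → ℕ}
    (h : IsCritical g X ω) (hm : g X.card ≤ m) :
    (bitLaw p).real {x | ∀ j < g X.card, ∑ v ∈ X, entry (fun v t => x (v, t)) ω v j ≠ 1} ≤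
      Real.exp (-(a / 64)) ^ X.card := by
  have ha0 : 0 < a := by linarith
  have hbits : ∀ x : Fin n × Fin m → Bool, ∀ j,
      ∑ v ∈ X, entry (fun v t => x (v, t)) ω v j = ∑ i ∈ cells m X ω j, (x i).toNat := by
    intro x j
    rw [sum_cells]
    rfl
  have hload : ∀ j ∈ Finset.range (g X.card),
      ∑ i ∈ cells m X ω j, (p i : ℝ) = load a X ω j := by
    intro j hj
    have hj' := Finset.mem_range.1 hj
    rw [sum_cells, load]
    refine Finset.sum_congr rfl fun v _ => ?_
    by_cases hv : ω v ≤ j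
    · rw [dif_pos ⟨hv, by omega⟩, if_pos hv, hp]
    · rw [dif_neg fun h' => hv h'.1, if_neg hv]
  simp_rw [hbits, ← Finset.mem_range]
  refine (bitLaw_real_forall_ne_one_le (fun i => (hp i).trans_le (density_le_half ha0 _)) _
    (pairwise_disjoint_cells X ω)).trans ?_
  rw [Finset.sum_congr rfl fun j hj => by rw [hload j hj], ← Real.exp_nat_mul, Real.exp_le_exp]
  linarith [h.le_sum_load_mul_exp ha hg]

/-- The number of activation times times the failure probability per node. -/
theorem delay_mul_exp_le (hn : 1 ≤ n) :
    n * (delay (2 ^ 24) n n * Real.exp (-(64 * lg n))) ≤ 1 / 2 := by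
  have hn' : (1 : ℝ) ≤ n := by exact_mod_cast hn
  have hL := lg_pos (n : ℝ)
  have hL1 := one_le_lg (n : ℝ)
  have hLn := lg_le_self hn'
  have hr := rate_le_sq hn
  have hr1 := one_le_rate hn
  have hM : (delay (2 ^ 24) n n : ℝ) ≤ 2 ^ 25 * (n : ℝ) ^ 3 := by
    rw [delay_eq]
    refine (Nat.ceil_lt_add_one (by positivity)).le.trans ?_
    have h1 : rate n * lg n ≤ (n : ℝ) ^ 2 * n := by gcongr
    have h2 : (1 : ℝ) ≤ (n : ℝ) ^ 2 * n := by nlinarith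
    nlinarith
  have he : (n : ℝ) ^ 4 * 2 ^ 26 ≤ Real.exp (64 * lg n) := by
    have h1 : (n : ℝ) ≤ Real.exp (lg n) := by
      rw [← Real.log_le_iff_le_exp (by linarith)]
      exact log_le_lg hn'
    have h2 : (2 : ℝ) ≤ Real.exp (lg n) := by linarith [Real.add_one_le_exp (lg n)]
    calc (n : ℝ) ^ 4 * 2 ^ 26 ≤ (n : ℝ) ^ 4 * 2 ^ 60 := by gcongr <;> norm_num
      _ ≤ Real.exp (lg n) ^ 4 * Real.exp (lg n) ^ 60 := by gcongr
      _ = Real.exp (64 * lg n) := by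
        rw [← pow_add, ← Real.exp_nat_mul]
        norm_num
  rw [Real.exp_neg, ← div_eq_mul_inv, ← mul_div_assoc, div_le_iff₀ (Real.exp_pos _)]
  calc (n : ℝ) * delay (2 ^ 24) n n ≤ n * (2 ^ 25 * (n : ℝ) ^ 3) := by gcongr
    _ = 1 / 2 * ((n : ℝ) ^ 4 * 2 ^ 26) := by ring
    _ ≤ _ := by gcongr

/-- Random sequences with `a = 2 ^ 12 lg n` and delay constant `2 ^ 24` work: the delay is then
`2 ^ 12 a rate q`, and a set of `q` nodes is missed with probability at most `exp (-64 q lg n)`. -/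
theorem exists_universalRadioSynchronizer (n : ℕ) :
    ∃ S : SeqFamily n (delay (2 ^ 24) n n),
      IsUniversalRadioSynchronizer n (delay (2 ^ 24) n) S := by
  classical
  rcases Nat.eq_zero_or_pos n with rfl | hn
  · exact ⟨fun v => v.elim0, (delay_mono (by norm_num) 0).monotoneOn _,
      fun _ _ hX => hX.choose.elim0⟩
  set g := delay (2 ^ 24) n with hgdef
  have hgmono : Monotone g := delay_mono (by norm_num) n
  set a := 4096 * lg n with ha_def
  have hL1 := one_le_lg (n : ℝ)
  have ha : 1 ≤ a := by linarith
  have ha0 : 0 < a := by linarith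
  have hg : ∀ q, g q = ⌈4096 * a * rate q⌉₊ := by
    intro q
    rw [hgdef, delay_eq, ha_def]
    congr 1
    ring
  have hg1 : 0 < g 1 := by
    rw [hg, Nat.ceil_pos]
    have := one_le_rate le_rfl
    positivity
  set m := g n
  set p : Fin n × Fin m → unitInterval := fun i =>
    ⟨density a i.2, density_nonneg ha0 _, (density_le_half ha0 _).trans (by norm_num)⟩ with hp
  set bad : (Fin n → Option (Fin m)) → Set (Fin n × Fin m → Bool) := fun σ =>
    {x | ∀ j < g (participants σ).card,
      ∑ v ∈ participants σ, entry (fun v t => x (v, t)) (times σ) v j ≠ 1}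
  set K : Finset (Fin n → Option (Fin m)) :=
    Finset.univ.filter fun σ => IsCritical g (participants σ) (times σ) with hK
  set y := Real.exp (-(a / 64)) with hy
  have hy64 : y = Real.exp (-(64 * lg n)) := by
    rw [hy, ha_def]
    congr 1
    ring
  have hy0 : 0 < y := Real.exp_pos _
  have hbad : (bitLaw p).real (⋃ σ ∈ K, bad σ) < 1 := by
    -- The empty schedule has weight `1` and has to be left out of the union bound.
    have h0 : (fun _ => none : Fin n → Option (Fin m)) ∉ K := by
      intro h
      obtain ⟨v, hv⟩ := (Finset.mem_filter.1 h).2.1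
      simp [participants] at hv
    calc (bitLaw p).real (⋃ σ ∈ K, bad σ) ≤ ∑ σ ∈ K, (bitLaw p).real (bad σ) :=
          measureReal_biUnion_finset_le _ _
      _ ≤ ∑ σ ∈ K, y ^ (participants σ).card := by
          refine Finset.sum_le_sum fun σ hσ => ?_
          refine (Finset.mem_filter.1 hσ).2.bitLaw_real_le ha hg (fun i => rfl) (hgmono ?_)
          exact (Finset.card_le_univ _).trans_eq (Fintype.card_fin n)
      _ ≤ ∑ σ ∈ Finset.univ.erase fun _ => none, y ^ (participants σ).card := by
          refine Finset.sum_le_sum_of_subset_of_nonneg (fun σ hσ => ?_) fun _ _ _ => by positivity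
          refine Finset.mem_erase.2 ⟨?_, Finset.mem_univ _⟩
          rintro rfl
          exact h0 hσ
      _ = (1 + m * y) ^ n - 1 := by
          rw [← sum_pow_card_participants, ← Finset.add_sum_erase _ _ (Finset.mem_univ fun _ => none)]
          simp [participants]
      _ ≤ Real.exp (m * y) ^ n - 1 := by
          gcongr
          linarith [Real.add_one_le_exp (m * y)]
      _ ≤ Real.exp (1 / 2) - 1 := by
          rw [← Real.exp_nat_mul]
          gcongr
          rw [hy64]
          exact delay_mul_exp_le hn
      _ < 1 := by
          have h1 : Real.exp (1 / 2) ^ 2 = Real.exp 1 := by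
            rw [← Real.exp_nat_mul]
            norm_num
          have h2 := Real.exp_one_lt_d9
          have h3 := Real.exp_pos (1 / 2 : ℝ)
          nlinarith
  obtain ⟨x, hx⟩ : ∃ x, x ∉ ⋃ σ ∈ K, bad σ := by
    by_contra! hall
    rw [Set.eq_univ_of_forall hall] at hbad
    simp at hbad
  refine ⟨fun v t => x (v, t), isUniversalRadioSynchronizer_of_critical hgmono fun X ω h => ?_⟩
  obtain ⟨σ, rfl, hσ⟩ := exists_code (M := m) (X := X) (ω := ω) fun v hv =>
    (h.lt hgmono hg1 hv).trans_le
      (hgmono ((Finset.card_le_univ _).trans_eq (Fintype.card_fin n)))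
  by_contra! hmiss
  refine hx (Set.mem_iUnion₂.2 ⟨σ, Finset.mem_filter.2 ⟨Finset.mem_univ _, h.congr hσ⟩, ?_⟩)
  intro j hj
  rw [Finset.sum_congr rfl fun v hv => by
    rw [show entry (fun v t => x (v, t)) (times σ) v j = entry (fun v t => x (v, t)) ω v j by
      simp only [entry, hσ v hv]]]
  exact hmiss j hj

end Existence

end RadioWakeUp

end

theorem theorem5 :
    -- for some constant `c`, the synchronizers that the algorithm runs exist for all `n`
    (∃ c : ℝ, 0 < c ∧ ∀ n : ℕ,
      ∃ S : RadioWakeUp.SeqFamily n (RadioWakeUp.delay c n n),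
        RadioWakeUp.IsUniversalRadioSynchronizer n (RadioWakeUp.delay c n) S) ∧
    -- with any such synchronizers, the algorithm wakes up every network within the claimed time,
    -- counted from the first spontaneous wake-up (of a node `s`, in time step `t₀`)
    (∀ c : ℝ, 0 < c → ∃ C : ℝ, 0 < C ∧
      ∀ (n : ℕ) (S : RadioWakeUp.SeqFamily n (RadioWakeUp.delay c n n)),
        RadioWakeUp.IsUniversalRadioSynchronizer n (RadioWakeUp.delay c n) S →
        ∀ (N : RadioWakeUp.RadioNetwork n) (wake : Fin n → Option ℕ) (s : Fin n) (t₀ : ℕ),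
          wake s = some t₀ → (∀ v i, wake v = some i → t₀ ≤ i) →
          RadioWakeUp.WakesUpWithin N (RadioWakeUp.wakeUpAlgorithm S) wake t₀
            (C * (min (n : ℝ) ((N.ecc s : ℝ) * (N.maxInDegree : ℝ)) * RadioWakeUp.lg n *
              RadioWakeUp.lg N.maxInDegree /
                RadioWakeUp.lg (RadioWakeUp.lg N.maxInDegree)))) := by
  refine ⟨⟨2 ^ 24, by norm_num, RadioWakeUp.exists_universalRadioSynchronizer⟩, fun c hc => ?_⟩
  exact ⟨2 * c + 1, by linarith, fun n S hS N wake s t₀ hs _ =>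
    RadioWakeUp.wakesUpWithin_of_synchronizer hc hS N hs⟩
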